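/- Let $n>1$ and $B>0$ be real, and consider the autonomous system $$\frac{dw}{dt}=q,\qquad \frac{dq}{dt}=-2G^1(w,q),\qquad G^1(w,q)=\frac12\Big[-\frac{n-5}{n-1}\,q+\frac{2(3-n)}{(n-1)^2}\,w+B^{n-1}w^n\Big].$$ In the real system, $w^n$ for $w<0$ means $\sigma|w|^n$ with a real constant $\sigma$ (for an integer $n$ and $\sigma=(-1)^n$ this is the usual power). Put $\rho=\frac1B\Big(\frac{2|n-3|}{(n-1)^2}\Big)^{1/(n-1)}$. Let $X_0=(0,0)$, let $X_n=(\rho,0)$ if $n>3$, and let $X_n=\big((-1)^{1/(n-1)}\rho,0\big)$ if $1<n<3$. For $1<n<3$ the root $(-1)^{1/(n-1)}$ is any of its values $e^{(2k+1)\pi i/(n-1)}$, $k\in\mathbb Z$; the system is then considered for $(w,q)\in\mathbb C^2$ and real time $t$, with the branch of $w^n=e^{n\log w}$ near $X_n$ for which $\log w=\log\rho+(2k+1)\pi i/(n-1)$ at $X_n$. A critical point is called linearly stable if all eigenvalues of the Jacobian matrix there have negative real part. It is a nodal sink if the eigenvalues are real, distinct and negative, a saddle if they are real and of opposite sign, and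 a spiral sink (spiral source) if they are $a\pm bi$ with $b\neq0$ and $a<0$ ($a>0$). It is stable if for every $\varepsilon>0$ there is $\delta>0$ such that from every initial value at distance less than $\delta$ a solution exists for all $t\ge0$ and every solution stays at distance less than $\varepsilon$. It is asymptotically stable if moreover all solutions on $[0,\infty)$ that start close enough to it converge to it, and unstable if it is not stable. Then: 1. For every $\sigma$, $X_0$ is a critical point, and it is linearly stable if and only if $n<3$. For $1<n<3$ it is a nodal sink and asymptotically stable. For $n>3$ it is a saddle and unstable. 2. Let $n>3$. For every $\sigma$, $X_n$ is a critical point, and it is linearly stable if and only if $n<5$. For $3<n<5$ it is asymptotically stable; it is a nodal sink if $3<n<(11+8\sqrt2)/7$ and a spiral sink if $(11+8\sqrt2)/7<n<5$. For $n>5$ it is a spiral source and unstable. 3. Let $1<n<3$. For every $k\in\mathbb Z$, $X_n$ is a critical point of the system in $\mathbb C^2$; it is a saddle, not linearly stable, and unstable. The same holds for the critical point $(-\rho,0)$ of the real system with $w^n=|w|^n$ for $w<0$ (the real reading, with $(-1)^{1/(n-1)}=-1$, for example for $n=2$). -/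

import Mathlib

noncomputable section

namespace EmdenFowler

open Set Filter Topology

/-! ### Stability of a point of an autonomous system `x' = f x` -/

section Stability

variable {E : Type*} [NormedAddCommGroup E] [NormedSpace ℝ E]

/-- `p` is a stable point of `x' = f x`: for every `ε > 0` there is `δ > 0` such that from every
initial value at distance less than `δ` from `p` a solution exists for all `t ≥ 0`, and every
solution (also one that is given on a bounded interval `[0, T]` only) stays at distance less than
`ε` from `p`. -/
def IsStable (f : E → E) (p : E) : Prop :=
  ∀ ε > 0, ∃ δ > 0, ∀ y : E, dist y p < δ →
    (∃ γ : ℝ → E, γ 0 = y ∧ IsIntegralCurveOn γ (fun _ => f) (Ici 0)) ∧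
    ∀ T : ℝ, 0 ≤ T → ∀ γ : ℝ → E, γ 0 = y → IsIntegralCurveOn γ (fun _ => f) (Icc 0 T) →
      ∀ t ∈ Icc 0 T, dist (γ t) p < ε

/-- `p` is an unstable point of `x' = f x`. -/
def IsUnstable (f : E → E) (p : E) : Prop := ¬ IsStable f p

/-- `p` is stable, and every solution on `[0, ∞)` that starts close enough to `p` tends to `p`. -/
def IsAsymptoticallyStable (f : E → E) (p : E) : Prop :=
  IsStable f p ∧ ∃ δ > 0, ∀ γ : ℝ → E, dist (γ 0) p < δ →
    IsIntegralCurveOn γ (fun _ => f) (Ici 0) → Tendsto γ atTop (𝓝 p)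

end Stability

/-! ### Linear type of a critical point of a planar system

The scalar field `𝕜` is `ℝ` or `ℂ`; the phase plane is `𝕜 × 𝕜`. -/

section Linear

variable {𝕜 : Type*} [RCLike 𝕜] [Algebra 𝕜 ℂ]

/-- The Jacobian matrix of `f` at `p` in the coordinates `(w, q)`. -/
def jacobian (f : 𝕜 × 𝕜 → 𝕜 × 𝕜) (p : 𝕜 × 𝕜) : Matrix (Fin 2) (Fin 2) 𝕜 :=
  LinearMap.toMatrix (Module.Basis.finTwoProd 𝕜) (Module.Basis.finTwoProd 𝕜)
    (fderiv 𝕜 f p : 𝕜 × 𝕜 →ₗ[𝕜] 𝕜 × 𝕜)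

/-- The two complex eigenvalues of the Jacobian matrix, with multiplicity. -/
def eigenvalues (f : 𝕜 × 𝕜 → 𝕜 × 𝕜) (p : 𝕜 × 𝕜) : Multiset ℂ :=
  ((jacobian f p).map (algebraMap 𝕜 ℂ)).charpoly.roots

/-- `f` vanishes at `p` and can be linearized there. -/
def IsCriticalPoint (f : 𝕜 × 𝕜 → 𝕜 × 𝕜) (p : 𝕜 × 𝕜) : Prop :=
  f p = 0 ∧ DifferentiableAt 𝕜 f p

/-- Linear stability: every eigenvalue of the Jacobian has negative real part. -/
def IsLinearlyStable (f : 𝕜 × 𝕜 → 𝕜 × 𝕜) (p : 𝕜 × 𝕜) : Prop :=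
  ∀ z ∈ eigenvalues f p, z.re < 0

/-- The eigenvalues are real, distinct and negative. -/
def IsNodalSink (f : 𝕜 × 𝕜 → 𝕜 × 𝕜) (p : 𝕜 × 𝕜) : Prop :=
  IsCriticalPoint f p ∧
    ∃ a b : ℝ, a < b ∧ b < 0 ∧ eigenvalues f p = {(a : ℂ), (b : ℂ)}

/-- The eigenvalues are real and of opposite sign. -/
def IsSaddle (f : 𝕜 × 𝕜 → 𝕜 × 𝕜) (p : 𝕜 × 𝕜) : Prop :=
  IsCriticalPoint f p ∧
    ∃ a b : ℝ, a < 0 ∧ 0 < b ∧ eigenvalues f p = {(a : ℂ), (b : ℂ)}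

/-- The eigenvalues are `a ± b i` with `a < 0` and `b ≠ 0`. -/
def IsSpiralSink (f : 𝕜 × 𝕜 → 𝕜 × 𝕜) (p : 𝕜 × 𝕜) : Prop :=
  IsCriticalPoint f p ∧
    ∃ a b : ℝ, a < 0 ∧ 0 < b ∧
      eigenvalues f p = {(a : ℂ) + b * Complex.I, (a : ℂ) - b * Complex.I}

/-- The eigenvalues are `a ± b i` with `a > 0` and `b ≠ 0`. -/
def IsSpiralSource (f : 𝕜 × 𝕜 → 𝕜 × 𝕜) (p : 𝕜 × 𝕜) : Prop :=
  IsCriticalPoint f p ∧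
    ∃ a b : ℝ, 0 < a ∧ 0 < b ∧
      eigenvalues f p = {(a : ℂ) + b * Complex.I, (a : ℂ) - b * Complex.I}

end Linear

/-! ### The autonomous system -/

section System

variable {𝕜 : Type*} [RCLike 𝕜]

/-- `G¹(w, q) = ½ (-(n-5)/(n-1) q + 2(3-n)/(n-1)² w + B^(n-1) w^n)`, where `P w` stands for the
power `w^n`. -/
def G1 (n B : ℝ) (P : 𝕜 → 𝕜) (w q : 𝕜) : 𝕜 :=
  (1 / 2 : ℝ) • (-(((n - 5) / (n - 1)) • q) + (2 * (3 - n) / (n - 1) ^ 2) • w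
    + (B ^ (n - 1)) • P w)

/-- The right-hand side of `dw/dt = q`, `dq/dt = -2 G¹(w, q)`. -/
def field (n B : ℝ) (P : 𝕜 → 𝕜) (x : 𝕜 × 𝕜) : 𝕜 × 𝕜 :=
  (x.2, -2 * G1 n B P x.1 x.2)

end System

/-- The real power `w^n` for `w ≥ 0`, continued to `w < 0` by `σ |w|^n`. For a natural number `n`
and `σ = (-1)^n` this is the usual power. -/
def realPow (σ n w : ℝ) : ℝ := if 0 ≤ w then w ^ n else σ * (-w) ^ n

/-- The branch of `w^n` near `exp s` that is given by the branch of `log w` with value `s` at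
`exp s`. It is holomorphic near `exp s` and equals `exp (n * s)` there. -/
def branchPow (s : ℂ) (n : ℝ) (w : ℂ) : ℂ :=
  Complex.exp (n * (s + Complex.log (w * Complex.exp (-s))))

/-- The first coordinate of the nontrivial critical point for `n > 3`, and its modulus for
`1 < n < 3`: `(1/B) (2|n-3|/(n-1)²)^(1/(n-1))`. -/
def rho (n B : ℝ) : ℝ := 1 / B * (2 * |n - 3| / (n - 1) ^ 2) ^ (1 / (n - 1))

/-- The logarithm `log ρ + (2k+1)πi/(n-1)` of the number `(-1)^(1/(n-1)) ρ`, where the integer `k`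
selects the value `exp ((2k+1)πi/(n-1))` of the root of `-1`. -/
def logRoot (n B : ℝ) (k : ℤ) : ℂ :=
  (Real.log (rho n B) : ℂ) + (2 * k + 1) * Real.pi * Complex.I / ((n : ℂ) - 1)

end EmdenFowler

end

/-! The field has the form (q, a q + g(w)) with a = (n-5)/(n-1) and g = `forcing`. At a zero w₀ of g
with real derivative d, the Jacobian is a companion matrix with characteristic polynomial X² - aX -
d, so the linear type depends only on the signs of a, d and a² + 4d. At the origin the power has
derivative 0 and a² + 4d = 1. At the nontrivial points `mul_rho_rpow` gives d = -2(n-3)/(n-1), for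
every complex branch and for the real reading alike.

The nonlinear claims rest on the form V = α|u|² + 2β⟨u,q⟩ + |q|², u = w - w₀. With α = -βa - d its
derivative along the linearization is diagonal, 2βd|u|² + 2(β+a)|q|². If β makes both coefficients
negative and V is positive definite, Lyapunov's theorem applies; if both are positive, Chetaev's
does. Only the real inner product enters, so one instability argument serves both ℝ² and ℂ². -/

namespace EmdenFowler

open Set Filter Topology

/-! ### Lyapunov and Chetaev theorems for autonomous systems. -/

section Lyapunov

variable {E : Type*} [NormedAddCommGroup E] [NormedSpace ℝ E]

/-- A bounded, globally Lipschitz vector field has solutions for all nonnegative times. -/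
theorem exists_isIntegralCurveOn_Ici [CompleteSpace E] {f : E → E} {K M : NNReal}
    (hf : LipschitzWith K f) (hM : ∀ x, ‖f x‖ ≤ M) (y : E) :
    ∃ γ : ℝ → E, γ 0 = y ∧ IsIntegralCurveOn γ (fun _ => f) (Ici 0) := by
  have hloc : ∀ N : ℕ, ∃ α : ℝ → E, α 0 = y ∧ IsIntegralCurveOn α (fun _ => f) (Icc 0 (N : ℝ)) := by
    intro N
    have h0 : (0 : ℝ) ∈ Icc (0 : ℝ) N := ⟨le_rfl, N.cast_nonneg⟩
    -- Speed at most `M` keeps the curve within `M * N` of `y` up to time `N`, so Picard-Lindelöf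
    -- covers all of `[0, N]`.
    have hPL : IsPicardLindelof (fun _ => f) (⟨0, h0⟩ : Icc (0 : ℝ) N) y (M * N) 0 M K :=
      { lipschitzOnWith := fun _ _ => hf.lipschitzOnWith
        continuousOn := fun _ _ => continuousOn_const
        norm_le := fun _ _ x _ => hM x
        mul_max_le := by simp }
    exact hPL.exists_eq_forall_mem_Icc_hasDerivWithinAt₀
  choose α hα0 hα using hloc
  have huniq : ∀ {m N : ℕ}, m ≤ N → EqOn (α m) (α N) (Icc 0 (m : ℝ)) := by
    intro m N hmN
    have hN : IsIntegralCurveOn (α N) (fun _ => f) (Icc 0 (m : ℝ)) :=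
      (hα N).mono (Icc_subset_Icc_right (by exact_mod_cast hmN))
    refine ODE_solution_unique_of_mem_Icc_right (v := fun _ => f) (s := fun _ => univ) (K := K)
      (fun _ _ => hf.lipschitzOnWith) (hα m).continuousOn
      (fun t ht => ((hα m) t (Ico_subset_Icc_self ht)).mono_of_mem_nhdsWithin
        (Icc_mem_nhdsGE_of_mem ht)) (fun _ _ => mem_univ _) hN.continuousOn
      (fun t ht => (hN t (Ico_subset_Icc_self ht)).mono_of_mem_nhdsWithin
        (Icc_mem_nhdsGE_of_mem ht)) (fun _ _ => mem_univ _) (by rw [hα0, hα0])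
  -- By uniqueness the choice of piece is immaterial, so taking the piece with index `⌈t⌉₊` at time
  -- `t` glues them.
  have hglue : ∀ N : ℕ, EqOn (fun t => α ⌈t⌉₊ t) (α N) (Icc 0 (N : ℝ)) := by
    intro N t ht
    exact huniq (Nat.ceil_le.2 ht.2) ⟨ht.1, Nat.le_ceil t⟩
  refine ⟨fun t => α ⌈t⌉₊ t, hα0 _, fun t ht => ?_⟩
  obtain ⟨N, hN⟩ := exists_nat_gt t
  have htN : t ∈ Icc (0 : ℝ) N := ⟨ht, hN.le⟩
  have hmem : Icc (0 : ℝ) N ∈ 𝓝[Ici 0] t := by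
    rw [← Ici_inter_Iic]
    exact inter_mem self_mem_nhdsWithin (mem_nhdsWithin_of_mem_nhds (Iic_mem_nhds hN))
  have h := (hα N t htN).congr (hglue N) (hglue N htN)
  rw [← hglue N htN] at h
  exact h.mono_of_mem_nhdsWithin hmem

theorem hasDerivWithinAt_comp_integralCurve {f : E → E} {γ : ℝ → E} {S : Set ℝ}
    (hγ : IsIntegralCurveOn γ (fun _ => f) S) {V : E → ℝ} (hV : Differentiable ℝ V) {t : ℝ}
    (ht : t ∈ S) :
    HasDerivWithinAt (fun t => V (γ t)) (fderiv ℝ V (γ t) (f (γ t))) S t :=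
  (hV (γ t)).hasFDerivAt.comp_hasDerivWithinAt t (hγ t ht)

/-- Exponential decay of a Lyapunov function along a solution. -/
theorem le_mul_exp_of_fderiv_le {f : E → E} {p : E} {V : E → ℝ} {r κ c T : ℝ} {γ : ℝ → E}
    (hV : Differentiable ℝ V) (hκ : 0 < κ) (hc : 0 < c)
    (hsub : ∀ x, V x ≤ c → x ∈ Metric.ball p r)
    (hdec : ∀ x ∈ Metric.ball p r, fderiv ℝ V x (f x) ≤ -κ * V x)
    (hγ : IsIntegralCurveOn γ (fun _ => f) (Icc 0 T)) (h0 : V (γ 0) ≤ c) :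
    ∀ t ∈ Icc 0 T, V (γ t) ≤ c * Real.exp (-(κ / 2) * t) := by
  have hB : ∀ t : ℝ, HasDerivAt (fun t => c * Real.exp (-(κ / 2) * t))
      (c * (Real.exp (-(κ / 2) * t) * (-(κ / 2)))) t := by
    intro t
    have h := ((hasDerivAt_id t).const_mul (-(κ / 2))).exp.const_mul c
    simpa using h
  intro t ht
  -- The comparison needs a strict inequality of derivatives at a contact point; halving the rate
  -- `κ` provides it. At contact V ≤ c, so the point lies in the ball where decay is known.
  refine image_le_of_deriv_right_lt_deriv_boundary (f := fun t => V (γ t))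
    (hV.continuous.comp_continuousOn hγ.continuousOn)
    (fun t ht => (hasDerivWithinAt_comp_integralCurve hγ hV
      (Ico_subset_Icc_self ht)).mono_of_mem_nhdsWithin (Icc_mem_nhdsGE_of_mem ht)) (by simpa using h0) hB ?_ ht
  intro s hs hVs
  have hpos : 0 < c * Real.exp (-(κ / 2) * s) := by positivity
  have hle : V (γ s) ≤ c := by
    rw [hVs]
    refine mul_le_of_le_one_right hc.le (Real.exp_le_one_iff.2 ?_)
    have := hs.1
    nlinarith
  have h := hdec _ (hsub _ hle)
  rw [hVs] at h
  nlinarith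

/-- **Lyapunov's theorem**: a quadratically bounded Lyapunov function that decays exponentially
gives asymptotic stability. The field is assumed to have a bounded Lipschitz extension from a
neighbourhood of the point. -/
theorem isAsymptoticallyStable_of_lyapunov [CompleteSpace E] {f g : E → E} {p : E} {V : E → ℝ}
    {r κ c₁ c₂ : ℝ} {K M : NNReal} (hV : Differentiable ℝ V) (hr : 0 < r) (hκ : 0 < κ)
    (hc₁ : 0 < c₁) (hc₂ : 0 < c₂) (hlow : ∀ x, c₁ * dist x p ^ 2 ≤ V x)
    (hup : ∀ x, V x ≤ c₂ * dist x p ^ 2)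
    (hdec : ∀ x ∈ Metric.ball p r, fderiv ℝ V x (f x) ≤ -κ * V x)
    (hgL : LipschitzWith K g) (hgM : ∀ x, ‖g x‖ ≤ M) (hfg : EqOn f g (Metric.ball p r)) :
    IsAsymptoticallyStable f p := by
  have hball : ∀ {m : ℝ}, 0 < m → ∀ x, V x ≤ c₁ * m ^ 2 / 2 → x ∈ Metric.ball p m := by
    intro m hm x hx
    rw [Metric.mem_ball]
    have h1 : c₁ * dist x p ^ 2 < c₁ * m ^ 2 := by
      have := hlow x
      have : 0 < c₁ * m ^ 2 := by positivity
      linarith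
    exact lt_of_pow_lt_pow_left₀ 2 hm.le (lt_of_mul_lt_mul_left h1 hc₁.le)
  have hstart : ∀ {c : ℝ}, 0 < c → ∀ x, dist x p < √(c / c₂) → V x ≤ c := by
    intro c hc x hx
    have h1 : dist x p ^ 2 < c / c₂ := (Real.lt_sqrt dist_nonneg).1 hx
    rw [lt_div_iff₀ hc₂] at h1
    have := hup x
    linarith
  have hdecg : ∀ x ∈ Metric.ball p r, fderiv ℝ V x (g x) ≤ -κ * V x := fun x hx => by
    rw [← hfg hx]; exact hdec x hx
  -- Stated for any field `h` with the decay property: with `g` it keeps the globally existing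
  -- solution in the ball, where it also solves `f`; with `f` it controls every given solution.
  have key : ∀ {m : ℝ}, 0 < m → m ≤ r → ∀ h : E → E,
      (∀ x ∈ Metric.ball p r, fderiv ℝ V x (h x) ≤ -κ * V x) → ∀ T : ℝ, ∀ γ : ℝ → E,
      dist (γ 0) p < √(c₁ * m ^ 2 / 2 / c₂) → IsIntegralCurveOn γ (fun _ => h) (Icc 0 T) →
      ∀ t ∈ Icc 0 T, V (γ t) ≤ c₁ * m ^ 2 / 2 * Real.exp (-(κ / 2) * t) := by
    intro m hm hmr h hh T γ h0 hγ
    have hc : 0 < c₁ * m ^ 2 / 2 := by positivity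
    exact le_mul_exp_of_fderiv_le hV hκ hc
      (fun x hx => Metric.ball_subset_ball hmr (hball hm x hx)) hh hγ (hstart hc _ h0)
  have keyball : ∀ {m : ℝ}, 0 < m → m ≤ r → ∀ h : E → E,
      (∀ x ∈ Metric.ball p r, fderiv ℝ V x (h x) ≤ -κ * V x) → ∀ T : ℝ, ∀ γ : ℝ → E,
      dist (γ 0) p < √(c₁ * m ^ 2 / 2 / c₂) → IsIntegralCurveOn γ (fun _ => h) (Icc 0 T) →
      ∀ t ∈ Icc 0 T, γ t ∈ Metric.ball p m := by
    intro m hm hmr h hh T γ h0 hγ t ht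
    refine hball hm _ ((key hm hmr h hh T γ h0 hγ t ht).trans ?_)
    refine mul_le_of_le_one_right (by positivity) (Real.exp_le_one_iff.2 ?_)
    have := ht.1
    nlinarith
  refine ⟨fun ε hε => ?_, √(c₁ * r ^ 2 / 2 / c₂), by positivity, fun γ h0 hγ => ?_⟩
  · have hm : 0 < min ε r := lt_min hε hr
    refine ⟨√(c₁ * min ε r ^ 2 / 2 / c₂), by positivity, fun y hy => ⟨?_, ?_⟩⟩
    · obtain ⟨γ, hγ0, hγ⟩ := exists_isIntegralCurveOn_Ici hgL hgM y
      refine ⟨γ, hγ0, fun t ht => ?_⟩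
      have hin : γ t ∈ Metric.ball p r :=
        Metric.ball_subset_ball (min_le_right _ _) (keyball hm (min_le_right _ _) g hdecg t γ
          (by rwa [hγ0]) (hγ.mono Icc_subset_Ici_self) t ⟨ht, le_rfl⟩)
      simpa only [hfg hin] using hγ t ht
    · intro T _ γ hγ0 hγ t ht
      exact (keyball hm (min_le_right _ _) f hdec T γ (by rwa [hγ0]) hγ t ht).trans_le
        (min_le_left _ _)
  · have hlim : Tendsto (fun t : ℝ => √(c₁ * r ^ 2 / 2 * Real.exp (-(κ / 2) * t) / c₁)) atTop
        (𝓝 0) := by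
      have h1 : Tendsto (fun t : ℝ => Real.exp (-(κ / 2) * t)) atTop (𝓝 0) :=
        Real.tendsto_exp_atBot.comp
          ((tendsto_const_mul_atBot_of_neg (by linarith)).2 tendsto_id)
      have h2 := ((h1.const_mul (c₁ * r ^ 2 / 2)).div_const c₁).sqrt
      simpa using h2
    rw [tendsto_iff_dist_tendsto_zero]
    refine squeeze_zero' (Eventually.of_forall fun _ => dist_nonneg) ?_ hlim
    filter_upwards [eventually_ge_atTop 0] with t ht
    refine Real.le_sqrt_of_sq_le ?_
    rw [le_div_iff₀ hc₁, mul_comm]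
    exact (hlow _).trans (key hr le_rfl f hdec t γ h0 (hγ.mono Icc_subset_Ici_self) t ⟨ht, le_rfl⟩)

/-- **Chetaev's theorem**: a function that grows exponentially along solutions near `p` and is
positive at points arbitrarily close to `p` gives instability. -/
theorem isUnstable_of_chetaev {f : E → E} {p : E} {V : E → ℝ} {r κ C : ℝ}
    (hV : Differentiable ℝ V) (hr : 0 < r) (hκ : 0 < κ)
    (hup : ∀ x ∈ Metric.ball p r, V x ≤ C)
    (hgrow : ∀ x ∈ Metric.ball p r, κ * V x ≤ fderiv ℝ V x (f x))
    (hpos : ∀ δ > 0, ∃ y, dist y p < δ ∧ 0 < V y) : IsUnstable f p := by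
  intro hst
  obtain ⟨δ, hδ, hst⟩ := hst r hr
  obtain ⟨y, hy, hVy⟩ := hpos δ hδ
  obtain ⟨⟨γ, hγ0, hγ⟩, hstay⟩ := hst y hy
  have hin : ∀ t, 0 ≤ t → γ t ∈ Metric.ball p r := fun t ht =>
    hstay t ht γ hγ0 (hγ.mono Icc_subset_Ici_self) t ⟨ht, le_rfl⟩
  -- V e^(-κt) is nondecreasing along a solution confined to the ball, so V grows at least like V(y)
  -- e^(κt), against the bound `C`.
  have hder : ∀ t ∈ Ici (0 : ℝ), HasDerivWithinAt (fun t => V (γ t) * Real.exp (-κ * t))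
      (fderiv ℝ V (γ t) (f (γ t)) * Real.exp (-κ * t)
        + V (γ t) * (Real.exp (-κ * t) * (-κ))) (Ici 0) t := by
    intro t ht
    have h := ((hasDerivAt_id t).const_mul (-κ)).exp.hasDerivWithinAt (s := Ici 0)
    exact (hasDerivWithinAt_comp_integralCurve hγ hV ht).mul (by simpa using h)
  have hmono : MonotoneOn (fun t => V (γ t) * Real.exp (-κ * t)) (Ici 0) := by
    refine monotoneOn_of_hasDerivWithinAt_nonneg (convex_Ici 0)
      (fun t ht => (hder t ht).continuousWithinAt)
      (fun t ht => (hder t (interior_subset ht)).mono interior_subset) ?_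
    intro t ht
    have h := hgrow _ (hin t (interior_subset ht))
    have he := Real.exp_pos (-κ * t)
    nlinarith
  have hbound : ∀ t, 0 ≤ t → V y * Real.exp (κ * t) ≤ C := by
    intro t ht
    have h := hmono (mem_Ici.2 le_rfl) (mem_Ici.2 ht) ht
    simp only [hγ0, mul_zero, Real.exp_zero, mul_one] at h
    have h2 := mul_le_mul_of_nonneg_right h (Real.exp_pos (κ * t)).le
    rw [mul_assoc, ← Real.exp_add] at h2
    simp only [neg_mul, neg_add_cancel, Real.exp_zero, mul_one] at h2
    exact h2.trans (hup _ (hin t ht))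
  have hlim : Tendsto (fun t : ℝ => V y * Real.exp (κ * t)) atTop atTop :=
    (Real.tendsto_exp_atTop.comp (tendsto_id.const_mul_atTop hκ)).const_mul_atTop hVy
  obtain ⟨t, ht, ht0⟩ := ((hlim.eventually_gt_atTop C).and (eventually_ge_atTop 0)).exists
  exact absurd (hbound t ht0) (not_le.2 ht)

end Lyapunov

/-! ### Stability and instability from the linearization, by a quadratic form. -/

section Quadratic

variable {F : Type*} [NormedAddCommGroup F] [InnerProductSpace ℝ F]

/-- The quadratic form `α ‖w - w₀‖² + 2 β ⟪w - w₀, q⟫ + ‖q‖²` on the phase plane. -/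
def quadForm (α β : ℝ) (w₀ : F) (x : F × F) : ℝ :=
  α * ‖x.1 - w₀‖ ^ 2 + 2 * β * inner ℝ (x.1 - w₀) x.2 + ‖x.2‖ ^ 2

theorem hasFDerivAt_quadForm (α β : ℝ) (w₀ : F) (x : F × F) :
    ∃ D : F × F →L[ℝ] ℝ, HasFDerivAt (quadForm α β w₀) D x ∧ ∀ v, D v =
      2 * α * inner ℝ (x.1 - w₀) v.1 + 2 * β * (inner ℝ v.1 x.2 + inner ℝ (x.1 - w₀) v.2)
        + 2 * inner ℝ x.2 v.2 := by
  have h1 : HasFDerivAt (fun x : F × F => x.1 - w₀) (ContinuousLinearMap.fst ℝ F F) x :=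
    hasFDerivAt_fst.sub_const w₀
  have h2 : HasFDerivAt (fun x : F × F => x.2) (ContinuousLinearMap.snd ℝ F F) x := hasFDerivAt_snd
  refine ⟨_, ((h1.norm_sq.const_mul α).add ((h1.inner ℝ h2).const_mul (2 * β))).add h2.norm_sq,
    fun v => ?_⟩
  simp [fderivInnerCLM_apply, inner_sub_left]
  ring

theorem differentiable_quadForm (α β : ℝ) (w₀ : F) : Differentiable ℝ (quadForm α β w₀) := fun x =>
  let ⟨_, hD, _⟩ := hasFDerivAt_quadForm α β w₀ x
  hD.differentiableAt

theorem fderiv_quadForm_apply (α β : ℝ) (w₀ : F) (x v : F × F) :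
    fderiv ℝ (quadForm α β w₀) x v =
      2 * α * inner ℝ (x.1 - w₀) v.1 + 2 * β * (inner ℝ v.1 x.2 + inner ℝ (x.1 - w₀) v.2)
        + 2 * inner ℝ x.2 v.2 := by
  obtain ⟨D, hD, h⟩ := hasFDerivAt_quadForm α β w₀ x
  rw [hD.fderiv, h]

/-- Turns a bound of the derivative by m(|u|² + |q|²) into one by a multiple of V, with rate κ = m /
C. -/
theorem abs_quadForm_le (α β : ℝ) (w₀ : F) (x : F × F) :
    |quadForm α β w₀ x| ≤ (|α| + |β| + 1) * (‖x.1 - w₀‖ ^ 2 + ‖x.2‖ ^ 2) := by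
  have h1 := abs_real_inner_le_norm (x.1 - w₀) x.2
  have h2 : |inner ℝ (x.1 - w₀) x.2| * 2 ≤ ‖x.1 - w₀‖ ^ 2 + ‖x.2‖ ^ 2 := by
    nlinarith [sq_nonneg (‖x.1 - w₀‖ - ‖x.2‖)]
  have h3 : |quadForm α β w₀ x| ≤ |α| * ‖x.1 - w₀‖ ^ 2 + |β| * (|inner ℝ (x.1 - w₀) x.2| * 2)
      + ‖x.2‖ ^ 2 := by
    unfold quadForm
    refine (abs_add_three _ _ _).trans (le_of_eq ?_)
    simp only [abs_mul, abs_pow, abs_norm, Nat.abs_ofNat]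
    ring
  have h4 := mul_le_mul_of_nonneg_left h2 (abs_nonneg β)
  have h5 : 0 ≤ |α| * ‖x.2‖ ^ 2 := by positivity
  have h6 : 0 ≤ ‖x.1 - w₀‖ ^ 2 := by positivity
  linarith

/-- The derivative of `quadForm` along the field `(q, a q + g w)` agrees up to a small error with
the one along the linearization `(q, a q + d (w - w₀))`. -/
theorem exists_ball_abs_fderiv_quadForm_sub_le {f : F × F → F × F} {g : F → F} {w₀ : F} {a d : ℝ}
    (hf : ∀ x, f x = (x.2, a • x.2 + g x.1))
    (hg : (fun w => g w - d • (w - w₀)) =o[𝓝 w₀] fun w => w - w₀) (β : ℝ) {m : ℝ} (hm : 0 < m) :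
    ∃ r > 0, ∀ x ∈ Metric.ball (w₀, (0 : F)) r,
      |fderiv ℝ (quadForm (-(β * a) - d) β w₀) x (f x)
        - (2 * (β * d) * ‖x.1 - w₀‖ ^ 2 + 2 * (β + a) * ‖x.2‖ ^ 2)|
        ≤ m * (‖x.1 - w₀‖ ^ 2 + ‖x.2‖ ^ 2) := by
  -- With |s| ≤ η|u| for the remainder s, the error is at most 2η(|β|+1)(|u|² + |q|²); this η makes
  -- it m(|u|² + |q|²).
  have hη : 0 < m / (2 * (|β| + 1)) := by positivity
  obtain ⟨r, hr, hball⟩ := Metric.eventually_nhds_iff_ball.1 (hg.def hη)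
  refine ⟨r, hr, fun x hx => ?_⟩
  have hx1 : x.1 ∈ Metric.ball w₀ r := Metric.mem_ball.2 ((le_max_left _ _).trans_lt hx)
  have hrem := hball _ hx1
  set u := x.1 - w₀ with hu
  set s := g x.1 - d • u with hs
  have hgs : g x.1 = d • u + s := by rw [hs]; abel
  -- The value α = -βa - d cancels the ⟨u,q⟩ terms, so only the remainder s survives.
  have hid : fderiv ℝ (quadForm (-(β * a) - d) β w₀) x (f x)
      - (2 * (β * d) * ‖u‖ ^ 2 + 2 * (β + a) * ‖x.2‖ ^ 2) = 2 * inner ℝ (β • u + x.2) s := by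
    rw [fderiv_quadForm_apply, hf, ← hu, hgs]
    simp only [inner_add_right, inner_add_left, inner_smul_right, inner_smul_left,
      real_inner_self_eq_norm_sq, real_inner_comm u x.2, conj_trivial]
    ring
  rw [hid, abs_mul, Nat.abs_ofNat]
  have h1 : |inner ℝ (β • u + x.2) s| ≤ (|β| * ‖u‖ + ‖x.2‖) * (m / (2 * (|β| + 1)) * ‖u‖) := by
    refine (abs_real_inner_le_norm _ _).trans ?_
    refine mul_le_mul ((norm_add_le _ _).trans ?_) hrem (norm_nonneg _) (by positivity)
    rw [norm_smul, Real.norm_eq_abs]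
  have h2 : (|β| * ‖u‖ + ‖x.2‖) * ‖u‖ ≤ (|β| + 1) * (‖u‖ ^ 2 + ‖x.2‖ ^ 2) := by
    have h5 : 0 ≤ |β| * ‖x.2‖ ^ 2 := by positivity
    nlinarith [sq_nonneg (‖u‖ - ‖x.2‖), sq_nonneg ‖u‖, sq_nonneg ‖x.2‖]
  calc 2 * |inner ℝ (β • u + x.2) s|
      ≤ 2 * ((|β| * ‖u‖ + ‖x.2‖) * (m / (2 * (|β| + 1)) * ‖u‖)) := by linarith
    _ = m / (|β| + 1) * ((|β| * ‖u‖ + ‖x.2‖) * ‖u‖) := by field_simp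
    _ ≤ m / (|β| + 1) * ((|β| + 1) * (‖u‖ ^ 2 + ‖x.2‖ ^ 2)) := by gcongr
    _ = m * (‖u‖ ^ 2 + ‖x.2‖ ^ 2) := by field_simp

/-- Instability by linearization: the characteristic polynomial `X² - a X - d` has a root with
positive real part and no purely imaginary root. -/
theorem isUnstable_of_linearization [Nontrivial F] {f : F × F → F × F} {g : F → F} {w₀ : F}
    {a d : ℝ} (hf : ∀ x, f x = (x.2, a • x.2 + g x.1))
    (hg : (fun w => g w - d • (w - w₀)) =o[𝓝 w₀] fun w => w - w₀)
    (had : 0 < d ∨ d < 0 ∧ 0 < a) : IsUnstable f (w₀, 0) := by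
  obtain ⟨β, hβd, hβa⟩ : ∃ β : ℝ, 0 < β * d ∧ 0 < β + a := by
    rcases had with hd | ⟨hd, ha⟩
    · exact ⟨|a| + 1, by positivity, by linarith [neg_abs_le a]⟩
    · exact ⟨-(a / 2), by nlinarith, by linarith⟩
  -- The diagonal part is at least 2m(|u|² + |q|²) and the error at most half of that.
  set m := min (β * d) (β + a) with hm
  have hm0 : 0 < m := lt_min hβd hβa
  obtain ⟨r, hr, hball⟩ := exists_ball_abs_fderiv_quadForm_sub_le hf hg β hm0
  set α := -(β * a) - d
  set C := |α| + |β| + 1 with hC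
  have hC0 : 0 < C := by positivity
  refine isUnstable_of_chetaev (V := quadForm α β w₀) (r := r) (κ := m / C)
    (C := C * (r ^ 2 + r ^ 2))
    (differentiable_quadForm _ _ _) hr (by positivity) ?_ ?_ ?_
  · intro x hx
    have hx1 : ‖x.1 - w₀‖ ≤ r := by
      rw [← dist_eq_norm]; exact ((le_max_left _ _).trans_lt hx).le
    have hx2 : ‖x.2‖ ≤ r := by
      rw [← dist_zero_right]; exact ((le_max_right _ _).trans_lt hx).le
    refine (le_abs_self _).trans ((abs_quadForm_le α β w₀ x).trans ?_)
    gcongr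
  · intro x hx
    have h1 := (abs_le.1 (hball x hx)).1
    have h2 := (le_abs_self _).trans (abs_quadForm_le α β w₀ x)
    have h3 : m / C * quadForm α β w₀ x ≤ m * (‖x.1 - w₀‖ ^ 2 + ‖x.2‖ ^ 2) := by
      calc m / C * quadForm α β w₀ x ≤ m / C * (C * (‖x.1 - w₀‖ ^ 2 + ‖x.2‖ ^ 2)) := by gcongr
        _ = _ := by field_simp
    have h4 : m * ‖x.1 - w₀‖ ^ 2 ≤ β * d * ‖x.1 - w₀‖ ^ 2 := by gcongr; exact min_le_left _ _
    have h5 : m * ‖x.2‖ ^ 2 ≤ (β + a) * ‖x.2‖ ^ 2 := by gcongr; exact min_le_right _ _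
    linarith
  · intro δ hδ
    -- On the fibre w = w₀ the form is |q|², hence positive arbitrarily near the point.
    obtain ⟨q, hq0, hq⟩ : ∃ q : F, 0 < ‖q‖ ∧ ‖q‖ < δ := by
      obtain ⟨v, hv⟩ := exists_norm_eq F (half_pos hδ).le
      exact ⟨v, by linarith, by linarith⟩
    refine ⟨(w₀, q), ?_, ?_⟩
    · simpa [Prod.dist_eq, hδ] using hq
    · have h : quadForm α β w₀ (w₀, q) = ‖q‖ ^ 2 := by simp [quadForm]
      rw [h]
      positivity

end Quadratic

/-- Asymptotic stability by linearization: both roots of the characteristic polynomial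
`X² - a X - d` have negative real part. -/
theorem isAsymptoticallyStable_of_linearization {f : ℝ × ℝ → ℝ × ℝ} {g : ℝ → ℝ} {w₀ a d : ℝ}
    (hf : ∀ x, f x = (x.2, a * x.2 + g x.1)) (hg0 : g w₀ = 0) (hg : HasStrictDerivAt g d w₀)
    (ha : a < 0) (hd : d < 0) : IsAsymptoticallyStable f (w₀, 0) := by
  have hgo : (fun w => g w - d • (w - w₀)) =o[𝓝 w₀] fun w => w - w₀ := by
    simpa [hg0, mul_comm] using hg.hasDerivAt.isLittleO
  -- Then V = (q - au/2)² + (a²/4 - d)u² is positive definite, and βd and β + a are both negative.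
  set β := -(a / 2) with hβ
  set α := -(β * a) - d with hα
  have hβd : 0 < -(β * d) := by rw [hβ]; nlinarith
  have hβa : 0 < -(β + a) := by rw [hβ]; linarith
  set m := min (-(β * d)) (-(β + a)) with hm
  have hm0 : 0 < m := lt_min hβd hβa
  obtain ⟨r₁, hr₁, hball⟩ := exists_ball_abs_fderiv_quadForm_sub_le hf hgo β hm0
  -- Strict differentiability is used here: it makes `g` Lipschitz on a neighbourhood, as existence
  -- of solutions requires.
  obtain ⟨K, S, hS, hK⟩ := hg.hasStrictFDerivAt.exists_lipschitzOnWith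
  obtain ⟨r₂, hr₂, hSr⟩ := Metric.nhds_basis_closedBall.mem_iff.1 hS
  set r := min r₁ r₂ with hr
  have hr0 : 0 < r := lt_min hr₁ hr₂
  set C := |α| + |β| + 1 with hC
  have hC0 : 0 < C := by positivity
  have hnorm : ∀ x : ℝ × ℝ, ‖x.1 - w₀‖ ^ 2 + ‖x.2‖ ^ 2 ≤ 2 * dist x (w₀, 0) ^ 2 := by
    intro x
    have h1 : ‖x.1 - w₀‖ ≤ dist x (w₀, 0) := by
      rw [← dist_eq_norm]; exact le_max_left _ _
    have h2 : ‖x.2‖ ≤ dist x (w₀, 0) := by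
      rw [← dist_zero_right]; exact le_max_right _ _
    have h3 := pow_le_pow_left₀ (norm_nonneg _) h1 2
    have h4 := pow_le_pow_left₀ (norm_nonneg _) h2 2
    linarith
  have hnorm' : ∀ x : ℝ × ℝ, dist x (w₀, 0) ^ 2 ≤ ‖x.1 - w₀‖ ^ 2 + ‖x.2‖ ^ 2 := by
    intro x
    rw [Prod.dist_eq, dist_eq_norm, dist_zero_right]
    rcases max_choice ‖x.1 - w₀‖ ‖x.2‖ with h | h <;> simp only [h] <;>
      linarith [sq_nonneg ‖x.1 - w₀‖, sq_nonneg ‖x.2‖]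
  -- From u² + q² ≤ (1 + a²/2)u² + 2(q - au/2)² and -d u² ≤ V, one gets u² + q² ≤ cV.
  set c : ℝ := (1 + a ^ 2 / 2) / (-d) + 2 with hc
  have hc0 : 0 < c := by
    have : 0 < -d := by linarith
    positivity
  -- Closed balls of the sup metric are boxes; clamping coordinates is a 1-Lipschitz retraction onto
  -- the box, so `f ∘ Φ` is a bounded Lipschitz extension.
  set Φ : ℝ × ℝ → ℝ × ℝ := fun x =>
    ((projIcc (w₀ - r) (w₀ + r) (by linarith) x.1 : ℝ), (projIcc (-r) r (by linarith) x.2 : ℝ))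
    with hΦ
  have hΦL : LipschitzWith 1 Φ := by
    have h1 := (LipschitzWith.subtype_val (Icc (w₀ - r) (w₀ + r))).comp
      ((LipschitzWith.projIcc (show w₀ - r ≤ w₀ + r by linarith)).comp
        (LipschitzWith.prod_fst (α := ℝ) (β := ℝ)))
    have h2 := (LipschitzWith.subtype_val (Icc (-r) r)).comp
      ((LipschitzWith.projIcc (show -r ≤ r by linarith)).comp
        (LipschitzWith.prod_snd (α := ℝ) (β := ℝ)))
    simpa using h1.prodMk h2
  have hΦmem : ∀ x, Φ x ∈ Metric.closedBall (w₀, (0 : ℝ)) r := by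
    intro x
    rw [← closedBall_prod_same, Real.closedBall_eq_Icc, Real.closedBall_eq_Icc, zero_sub, zero_add]
    exact ⟨Subtype.prop _, Subtype.prop _⟩
  have hΦid : ∀ x ∈ Metric.ball (w₀, (0 : ℝ)) r, Φ x = x := by
    intro x hx
    have hx' := Metric.ball_subset_closedBall hx
    rw [← closedBall_prod_same, Real.closedBall_eq_Icc, Real.closedBall_eq_Icc, zero_sub,
      zero_add] at hx'
    simp only [hΦ]
    rw [projIcc_of_mem _ hx'.1, projIcc_of_mem _ hx'.2]
  have hfL : ∃ K' : NNReal, LipschitzOnWith K' f (Metric.closedBall (w₀, (0 : ℝ)) r) := by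
    have h1 : LipschitzOnWith 1 (fun x : ℝ × ℝ => x.2) (Metric.closedBall (w₀, (0 : ℝ)) r) :=
      LipschitzWith.prod_snd.lipschitzOnWith
    have h2 := (lipschitzWith_smul (α := ℝ) (β := ℝ) a).comp_lipschitzOnWith h1
    have h3 := hK.comp (LipschitzWith.prod_fst (α := ℝ) (β := ℝ)).lipschitzOnWith
      (s := Metric.closedBall (w₀, (0 : ℝ)) r) (fun x hx => hSr
        (Metric.mem_closedBall.2 ((le_max_left _ _).trans (hx.trans (min_le_right _ _)))))
    obtain rfl : f = fun x => (x.2, a * x.2 + g x.1) := funext hf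
    exact ⟨_, h1.prodMk (h2.add h3)⟩
  obtain ⟨K', hK'⟩ := hfL
  have hgL : LipschitzWith K' (f ∘ Φ) := by
    have := hK'.comp (hΦL.lipschitzOnWith (s := univ)) fun x _ => hΦmem x
    simpa [lipschitzOnWith_univ] using this
  obtain ⟨M, hM⟩ : ∃ M : NNReal, ∀ x, ‖f (Φ x)‖ ≤ M := by
    obtain ⟨M, hM⟩ := (isCompact_closedBall (w₀, (0 : ℝ)) r).exists_bound_of_continuousOn
      hK'.continuousOn
    exact ⟨M.toNNReal, fun x => (hM _ (hΦmem x)).trans (Real.le_coe_toNNReal M)⟩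
  refine isAsymptoticallyStable_of_lyapunov (g := f ∘ Φ) (V := quadForm α β w₀) (r := r)
    (κ := m / C) (c₁ := 1 / c) (c₂ := C * 2) (differentiable_quadForm _ _ _) hr0 (by positivity)
    (by positivity) (by positivity) ?_ ?_ ?_ hgL hM ?_
  · intro x
    rw [one_div, inv_mul_le_iff₀ hc0]
    refine (hnorm' x).trans ?_
    set u := x.1 - w₀ with hu
    have hV : quadForm α β w₀ x = (x.2 - a / 2 * u) ^ 2 + (a ^ 2 / 4 - d) * u ^ 2 := by
      simp only [quadForm, ← hu, hα, hβ, Real.norm_eq_abs, sq_abs, RCLike.inner_apply, conj_trivial]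
      ring
    have hd' : 0 < -d := by linarith
    rw [hV, Real.norm_eq_abs, Real.norm_eq_abs, sq_abs, sq_abs]
    have h1 : (1 + a ^ 2 / 2) * u ^ 2 ≤ (1 + a ^ 2 / 2) / (-d) * ((x.2 - a / 2 * u) ^ 2
        + (a ^ 2 / 4 - d) * u ^ 2) := by
      rw [div_mul_eq_mul_div, le_div_iff₀ hd', mul_assoc]
      refine mul_le_mul_of_nonneg_left ?_ (by positivity)
      nlinarith [sq_nonneg (x.2 - a / 2 * u), sq_nonneg (a * u)]
    have h2 : u ^ 2 + x.2 ^ 2 ≤ (1 + a ^ 2 / 2) * u ^ 2 + 2 * (x.2 - a / 2 * u) ^ 2 := by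
      nlinarith [sq_nonneg (x.2 - a * u)]
    have h3 : 0 ≤ (a ^ 2 / 4 - d) * u ^ 2 := by
      have : 0 < a ^ 2 / 4 - d := by nlinarith [sq_nonneg a]
      positivity
    rw [hc, add_mul]
    linarith
  · intro x
    refine (le_abs_self _).trans ((abs_quadForm_le α β w₀ x).trans ?_)
    rw [mul_assoc]
    exact mul_le_mul_of_nonneg_left (hnorm x) hC0.le
  · intro x hx
    have h1 := (abs_le.1 (hball x (Metric.ball_subset_ball (min_le_left _ _) hx))).2
    have h2 := (le_abs_self _).trans (abs_quadForm_le α β w₀ x)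
    have h3 : m / C * quadForm α β w₀ x ≤ m * (‖x.1 - w₀‖ ^ 2 + ‖x.2‖ ^ 2) := by
      calc m / C * quadForm α β w₀ x ≤ m / C * (C * (‖x.1 - w₀‖ ^ 2 + ‖x.2‖ ^ 2)) := by gcongr
        _ = _ := by field_simp
    have h4 : m * ‖x.1 - w₀‖ ^ 2 ≤ -(β * d) * ‖x.1 - w₀‖ ^ 2 := by gcongr; exact min_le_left _ _
    have h5 : m * ‖x.2‖ ^ 2 ≤ -(β + a) * ‖x.2‖ ^ 2 := by gcongr; exact min_le_right _ _
    linarith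
  · intro x hx
    rw [Function.comp_apply, hΦid x hx]

/-! ### Eigenvalues and linear type of a companion system. -/

section Planar

variable {𝕜 : Type*} [RCLike 𝕜]

/-- The part of `-2 G¹` that depends on `w` only. -/
noncomputable def forcing (n B : ℝ) (P : 𝕜 → 𝕜) (w : 𝕜) : 𝕜 :=
  (2 * (n - 3) / (n - 1) ^ 2) • w - (B ^ (n - 1)) • P w

theorem field_apply (n B : ℝ) (P : 𝕜 → 𝕜) (x : 𝕜 × 𝕜) :
    field n B P x = (x.2, ((n - 5) / (n - 1)) • x.2 + forcing n B P x.1) := by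
  refine Prod.ext rfl ?_
  simp only [field, G1, forcing, RCLike.real_smul_eq_coe_mul]
  push_cast
  ring

/-- The derivative is kept as a cast real number even over ℂ, because the linear criteria need a
real d. -/
theorem hasStrictDerivAt_forcing {n B p : ℝ} {P : 𝕜 → 𝕜} {w₀ : 𝕜}
    (hP : HasStrictDerivAt P (p : 𝕜) w₀) :
    HasStrictDerivAt (forcing n B P)
      ((2 * (n - 3) / (n - 1) ^ 2 - B ^ (n - 1) * p : ℝ) : 𝕜) w₀ := by
  have h := ((hasStrictDerivAt_id w₀).const_mul ((2 * (n - 3) / (n - 1) ^ 2 : ℝ) : 𝕜)).sub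
    (hP.const_mul ((B ^ (n - 1) : ℝ) : 𝕜))
  simp only [mul_one] at h
  convert! h using 1
  · funext w
    simp [forcing, RCLike.real_smul_eq_coe_mul]
  · push_cast
    ring

variable {f : 𝕜 × 𝕜 → 𝕜 × 𝕜} {g : 𝕜 → 𝕜} {w₀ : 𝕜} {a d : ℝ}

theorem hasFDerivAt_planar (hf : ∀ x, f x = (x.2, a • x.2 + g x.1))
    (hg : HasDerivAt g (d : 𝕜) w₀) :
    HasFDerivAt f ((ContinuousLinearMap.snd 𝕜 𝕜 𝕜).prod ((a : 𝕜) • ContinuousLinearMap.snd 𝕜 𝕜 𝕜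
      + (d : 𝕜) • ContinuousLinearMap.fst 𝕜 𝕜 𝕜)) (w₀, 0) := by
  have h1 : HasFDerivAt (fun x : 𝕜 × 𝕜 => x.1) (ContinuousLinearMap.fst 𝕜 𝕜 𝕜) (w₀, (0 : 𝕜)) :=
    hasFDerivAt_fst
  have h2 : HasFDerivAt (fun x : 𝕜 × 𝕜 => x.2) (ContinuousLinearMap.snd 𝕜 𝕜 𝕜) (w₀, (0 : 𝕜)) :=
    hasFDerivAt_snd
  obtain rfl : f = fun x => (x.2, (a : 𝕜) • x.2 + g x.1) := by
    funext x
    rw [hf, RCLike.real_smul_eq_coe_smul (K := 𝕜)]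
  have hg' : HasDerivAt g (d : 𝕜) ((fun x : 𝕜 × 𝕜 => x.1) (w₀, (0 : 𝕜))) := hg
  exact h2.prodMk ((h2.const_smul (a : 𝕜)).add (hg'.comp_hasFDerivAt (w₀, (0 : 𝕜)) h1))

theorem isCriticalPoint_planar (hf : ∀ x, f x = (x.2, a • x.2 + g x.1)) (hg0 : g w₀ = 0)
    (hg : HasDerivAt g (d : 𝕜) w₀) : IsCriticalPoint f (w₀, 0) :=
  ⟨by simp [hf, hg0], (hasFDerivAt_planar hf hg).differentiableAt⟩

theorem jacobian_planar (hf : ∀ x, f x = (x.2, a • x.2 + g x.1))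
    (hg : HasDerivAt g (d : 𝕜) w₀) :
    jacobian f (w₀, 0) = !![0, 1; (d : 𝕜), (a : 𝕜)] := by
  rw [jacobian, (hasFDerivAt_planar hf hg).fderiv]
  ext i j
  fin_cases i <;> fin_cases j <;> simp [LinearMap.toMatrix_apply, RCLike.real_smul_eq_coe_mul]

variable [Algebra 𝕜 ℂ]

/-- Vieta: the sum and product of two numbers determine the monic quadratic. `hmap` ties the
arbitrary algebra structure on ℂ to the cast of reals. -/
theorem eigenvalues_planar (hmap : ∀ r : ℝ, algebraMap 𝕜 ℂ (r : 𝕜) = r)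
    (hf : ∀ x, f x = (x.2, a • x.2 + g x.1)) (hg : HasDerivAt g (d : 𝕜) w₀) {z₁ z₂ : ℂ}
    (hadd : z₁ + z₂ = a) (hmul : z₁ * z₂ = -d) : eigenvalues f (w₀, 0) = {z₁, z₂} := by
  have hchar : ((jacobian f (w₀, 0)).map (algebraMap 𝕜 ℂ)).charpoly
      = (Polynomial.X - Polynomial.C z₁) * (Polynomial.X - Polynomial.C z₂) := by
    rw [jacobian_planar hf hg, Matrix.charpoly_fin_two]
    have htr : (!![0, 1; (d : 𝕜), (a : 𝕜)].map (algebraMap 𝕜 ℂ)).trace = z₁ + z₂ := by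
      simp [Matrix.trace_fin_two, hmap, hadd]
    have hdet : (!![0, 1; (d : 𝕜), (a : 𝕜)].map (algebraMap 𝕜 ℂ)).det = z₁ * z₂ := by
      simp [Matrix.det_fin_two, hmap, hmul]
    rw [htr, hdet, map_add, map_mul]
    ring
  rw [eigenvalues, hchar, Polynomial.roots_mul (mul_ne_zero (Polynomial.X_sub_C_ne_zero _)
    (Polynomial.X_sub_C_ne_zero _)), Polynomial.roots_X_sub_C, Polynomial.roots_X_sub_C]
  rfl

theorem eigenvalues_planar_of_nonneg (hmap : ∀ r : ℝ, algebraMap 𝕜 ℂ (r : 𝕜) = r)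
    (hf : ∀ x, f x = (x.2, a • x.2 + g x.1)) (hg : HasDerivAt g (d : 𝕜) w₀)
    (hD : 0 ≤ a ^ 2 + 4 * d) : eigenvalues f (w₀, 0) =
      {(((a - √(a ^ 2 + 4 * d)) / 2 : ℝ) : ℂ), (((a + √(a ^ 2 + 4 * d)) / 2 : ℝ) : ℂ)} := by
  refine eigenvalues_planar hmap hf hg ?_ ?_ <;> norm_cast
  · ring
  · nlinarith [Real.sq_sqrt hD]

theorem eigenvalues_planar_of_neg (hmap : ∀ r : ℝ, algebraMap 𝕜 ℂ (r : 𝕜) = r)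
    (hf : ∀ x, f x = (x.2, a • x.2 + g x.1)) (hg : HasDerivAt g (d : 𝕜) w₀)
    (hD : a ^ 2 + 4 * d < 0) : eigenvalues f (w₀, 0) =
      {((a / 2 : ℝ) : ℂ) + (√(-(a ^ 2 + 4 * d)) / 2 : ℝ) * Complex.I,
        ((a / 2 : ℝ) : ℂ) - (√(-(a ^ 2 + 4 * d)) / 2 : ℝ) * Complex.I} := by
  have hs := Real.sq_sqrt (show 0 ≤ -(a ^ 2 + 4 * d) by linarith)
  refine eigenvalues_planar hmap hf hg ?_ ?_
  · push_cast
    ring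
  · have h : (a / 2) ^ 2 + (√(-(a ^ 2 + 4 * d)) / 2) ^ 2 = -d := by
      rw [div_pow √_, hs]
      ring
    rw [← sq_sub_sq, mul_pow, Complex.I_sq]
    have h' := congrArg ((↑) : ℝ → ℂ) h
    push_cast at h' ⊢
    linear_combination h'

/-- Real roots with sum a and product -d are both negative exactly when a < 0 and d < 0; for
non-real roots d < 0 is automatic and the real part is a/2. -/
theorem isLinearlyStable_planar_iff (hmap : ∀ r : ℝ, algebraMap 𝕜 ℂ (r : 𝕜) = r)
    (hf : ∀ x, f x = (x.2, a • x.2 + g x.1)) (hg : HasDerivAt g (d : 𝕜) w₀) :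
    IsLinearlyStable f (w₀, 0) ↔ a < 0 ∧ d < 0 := by
  rcases le_or_gt 0 (a ^ 2 + 4 * d) with hD | hD
  · simp only [IsLinearlyStable, eigenvalues_planar_of_nonneg hmap hf hg hD,
      Multiset.insert_eq_cons, Multiset.mem_cons, Multiset.mem_singleton, forall_eq_or_imp,
      forall_eq, Complex.ofReal_re]
    have h0 := Real.sqrt_nonneg (a ^ 2 + 4 * d)
    have hs := Real.sq_sqrt hD
    constructor
    · rintro ⟨_, h⟩
      refine ⟨by linarith, ?_⟩
      nlinarith
    · rintro ⟨ha, hd⟩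
      refine ⟨by linarith, ?_⟩
      have : √(a ^ 2 + 4 * d) < -a := by
        rw [Real.sqrt_lt' (by linarith)]
        linarith [neg_sq a]
      linarith
  · have hd : d < 0 := by nlinarith [sq_nonneg a]
    simp only [IsLinearlyStable, eigenvalues_planar_of_neg hmap hf hg hD,
      Multiset.insert_eq_cons, Multiset.mem_cons, Multiset.mem_singleton, forall_eq_or_imp,
      forall_eq, Complex.add_re, Complex.sub_re, Complex.ofReal_re, Complex.re_ofReal_mul,
      Complex.I_re, mul_zero, add_zero, sub_zero, hd, and_true, and_self]
    constructor <;> intro h <;> linarith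

theorem isNodalSink_planar (hmap : ∀ r : ℝ, algebraMap 𝕜 ℂ (r : 𝕜) = r)
    (hf : ∀ x, f x = (x.2, a • x.2 + g x.1)) (hg0 : g w₀ = 0) (hg : HasDerivAt g (d : 𝕜) w₀)
    (hD : 0 < a ^ 2 + 4 * d) (ha : a < 0) (hd : d < 0) : IsNodalSink f (w₀, 0) := by
  have h0 := Real.sqrt_pos.2 hD
  have h1 : √(a ^ 2 + 4 * d) < -a := by
    rw [Real.sqrt_lt' (by linarith)]
    linarith [neg_sq a]
  exact ⟨isCriticalPoint_planar hf hg0 hg, _, _, by linarith, by linarith,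
    eigenvalues_planar_of_nonneg hmap hf hg hD.le⟩

theorem isSaddle_planar (hmap : ∀ r : ℝ, algebraMap 𝕜 ℂ (r : 𝕜) = r)
    (hf : ∀ x, f x = (x.2, a • x.2 + g x.1)) (hg0 : g w₀ = 0) (hg : HasDerivAt g (d : 𝕜) w₀)
    (hd : 0 < d) : IsSaddle f (w₀, 0) := by
  have h1 : |a| < √(a ^ 2 + 4 * d) := by
    rw [← Real.sqrt_sq_eq_abs]
    exact Real.sqrt_lt_sqrt (sq_nonneg a) (by linarith)
  have h2 := abs_lt.1 h1
  exact ⟨isCriticalPoint_planar hf hg0 hg, _, _, by linarith [h2.2], by linarith [h2.1],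
    eigenvalues_planar_of_nonneg hmap hf hg (by positivity)⟩

theorem isSpiralSink_planar (hmap : ∀ r : ℝ, algebraMap 𝕜 ℂ (r : 𝕜) = r)
    (hf : ∀ x, f x = (x.2, a • x.2 + g x.1)) (hg0 : g w₀ = 0) (hg : HasDerivAt g (d : 𝕜) w₀)
    (hD : a ^ 2 + 4 * d < 0) (ha : a < 0) : IsSpiralSink f (w₀, 0) :=
  ⟨isCriticalPoint_planar hf hg0 hg, _, _, by linarith,
    half_pos (Real.sqrt_pos.2 (by linarith)), eigenvalues_planar_of_neg hmap hf hg hD⟩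

theorem isSpiralSource_planar (hmap : ∀ r : ℝ, algebraMap 𝕜 ℂ (r : 𝕜) = r)
    (hf : ∀ x, f x = (x.2, a • x.2 + g x.1)) (hg0 : g w₀ = 0) (hg : HasDerivAt g (d : 𝕜) w₀)
    (hD : a ^ 2 + 4 * d < 0) (ha : 0 < a) : IsSpiralSource f (w₀, 0) :=
  ⟨isCriticalPoint_planar hf hg0 hg, _, _, by linarith,
    half_pos (Real.sqrt_pos.2 (by linarith)), eigenvalues_planar_of_neg hmap hf hg hD⟩

end Planar

/-! ### Derivatives of the powers, and the nontrivial critical points. -/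

section Powers

/-- The power is max(w,0)^n + σ max(-w,0)^n. The maxima are not differentiable at 0, but they are
1-Lipschitz, and a strict derivative 0 survives composition with a Lipschitz map fixing 0. -/
theorem hasStrictDerivAt_realPow_zero (σ : ℝ) {n : ℝ} (hn : 1 < n) :
    HasStrictDerivAt (realPow σ n) 0 0 := by
  have hpow : HasStrictDerivAt (fun x : ℝ => x ^ n) 0 0 := by
    have h := Real.hasStrictDerivAt_rpow_const (x := 0) (p := n) (Or.inr hn.le)
    rwa [Real.zero_rpow (by linarith), mul_zero] at h
  have hlip : ∀ u : ℝ → ℝ, LipschitzWith 1 u → u 0 = 0 →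
      HasStrictDerivAt (fun x => u x ^ n) 0 0 := by
    intro u hu hu0
    have h := hpow.hasStrictFDerivAt.isLittleO
    simp only [ContinuousLinearMap.toSpanSingleton_zero, zero_apply,
      sub_zero] at h
    have hcont : Tendsto (fun x : ℝ × ℝ => (u x.1, u x.2)) (𝓝 (0, 0)) (𝓝 (0, 0)) := by
      have hc : Continuous fun x : ℝ × ℝ => (u x.1, u x.2) :=
        (hu.continuous.comp continuous_fst).prodMk (hu.continuous.comp continuous_snd)
      simpa [hu0] using hc.tendsto (0, 0)
    refine HasStrictFDerivAt.of_isLittleO ?_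
    simp only [ContinuousLinearMap.toSpanSingleton_zero, zero_apply, sub_zero]
    refine (h.comp_tendsto hcont).trans_isBigO (Asymptotics.IsBigO.of_bound 1 ?_)
    exact Eventually.of_forall fun x => by simpa [dist_eq_norm] using hu.dist_le_mul x.1 x.2
  have h1 := hlip (fun x => max x 0) (by simpa using LipschitzWith.id.max_const (0 : ℝ)) (by simp)
  have h2 := hlip (fun x => max (-x) 0)
    (by simpa using (LipschitzWith.id (α := ℝ)).neg.max_const (0 : ℝ)) (by simp)
  have h3 := h1.add (h2.const_mul σ)
  simp only [mul_zero, add_zero] at h3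
  refine h3.congr_of_eventuallyEq (Eventually.of_forall fun x => ?_)
  have hn0 : n ≠ 0 := by linarith
  rcases le_or_gt 0 x with hx | hx
  · simp [realPow, hx, Real.zero_rpow hn0]
  · simp [realPow, not_le.2 hx, hx.le, Real.zero_rpow hn0]

theorem hasStrictDerivAt_realPow_of_pos (σ n : ℝ) {w : ℝ} (hw : 0 < w) :
    HasStrictDerivAt (realPow σ n) (n * w ^ (n - 1)) w := by
  refine (Real.hasStrictDerivAt_rpow_const_of_ne hw.ne' n).congr_of_eventuallyEq ?_
  filter_upwards [lt_mem_nhds hw] with x hx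
  simp [realPow, hx.le]

theorem hasStrictDerivAt_realPow_one_of_neg (n : ℝ) {w : ℝ} (hw : w < 0) :
    HasStrictDerivAt (realPow 1 n) (-(n * (-w) ^ (n - 1))) w := by
  have h := (Real.hasStrictDerivAt_rpow_const_of_ne (neg_pos.2 hw).ne' n).comp w
    (hasStrictDerivAt_neg w)
  rw [mul_neg_one] at h
  refine h.congr_of_eventuallyEq ?_
  filter_upwards [gt_mem_nhds hw] with x hx
  simp [realPow, not_le.2 hx]

theorem branchPow_exp (s : ℂ) (n : ℝ) : branchPow s n (Complex.exp s) = Complex.exp (n * s) := by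
  simp [branchPow, ← Complex.exp_add]

/-- At `exp s` the logarithm is taken at 1, inside the slit plane, so the principal logarithm is
holomorphic there whatever the imaginary part of `s`. -/
theorem hasStrictDerivAt_branchPow (s : ℂ) (n : ℝ) :
    HasStrictDerivAt (branchPow s n) (n * Complex.exp ((n - 1) * s)) (Complex.exp s) := by
  have h1 : HasStrictDerivAt (fun w : ℂ => w * Complex.exp (-s)) (Complex.exp (-s))
      (Complex.exp s) := by
    simpa using (hasStrictDerivAt_id (Complex.exp s)).mul_const (Complex.exp (-s))
  have hone : Complex.exp s * Complex.exp (-s) = 1 := by simp [← Complex.exp_add]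
  have h2 := (((h1.clog (by rw [hone]; exact Complex.one_mem_slitPlane)).const_add s).const_mul
    (n : ℂ)).cexp
  rw [hone, Complex.log_one, add_zero, div_one] at h2
  convert! h2 using 1
  rw [mul_left_comm, ← Complex.exp_add]
  ring_nf

variable {n B : ℝ}

theorem rho_pos (hn : 1 < n) (hn3 : n ≠ 3) (hB : 0 < B) : 0 < rho n B := by
  have h1 : 0 < n - 1 := by linarith
  have h2 : 0 < |n - 3| := abs_pos.2 (sub_ne_zero.2 hn3)
  unfold rho
  positivity

/-- The nonzero critical point equation divided by w, in modulus; it yields both the zero of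
`forcing` and its derivative. -/
theorem mul_rho_rpow (hn : 1 < n) (hn3 : n ≠ 3) (hB : 0 < B) :
    B ^ (n - 1) * rho n B ^ (n - 1) = 2 * |n - 3| / (n - 1) ^ 2 := by
  have h1 : 0 < n - 1 := by linarith
  rw [← Real.mul_rpow hB.le (rho_pos hn hn3 hB).le, rho, ← mul_assoc, mul_one_div_cancel hB.ne',
    one_mul, ← Real.rpow_mul (by positivity), one_div_mul_cancel h1.ne', Real.rpow_one]

/-- Multiplication by n - 1 clears the denominator and leaves an odd multiple of πi. The value does
not depend on `k`, so all branches share one linearization. -/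
theorem exp_mul_logRoot (hn : 1 < n) (hρ : 0 < rho n B) (k : ℤ) :
    Complex.exp ((n - 1) * logRoot n B k) = ((-(rho n B ^ (n - 1)) : ℝ) : ℂ) := by
  have h1 : (n : ℂ) - 1 ≠ 0 := by
    have : (n : ℂ) ≠ 1 := by exact_mod_cast hn.ne'
    exact sub_ne_zero.2 this
  have h2 : ((n : ℂ) - 1) * logRoot n B k
      = ((Real.log (rho n B) * (n - 1) : ℝ) : ℂ)
        + (Real.pi * Complex.I + k * (2 * Real.pi * Complex.I)) := by
    unfold logRoot
    field_simp
    push_cast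
    ring
  rw [h2, Complex.exp_add, Complex.exp_add, Complex.exp_pi_mul_I, Complex.exp_int_mul_two_pi_mul_I,
    ← Complex.ofReal_exp, ← Real.rpow_def_of_pos hρ]
  push_cast
  ring

end Powers

theorem isUnstable_planar_real {f : ℝ × ℝ → ℝ × ℝ} {g : ℝ → ℝ} {w₀ a d : ℝ}
    (hf : ∀ x, f x = (x.2, a * x.2 + g x.1)) (hg0 : g w₀ = 0) (hg : HasDerivAt g d w₀)
    (had : 0 < d ∨ d < 0 ∧ 0 < a) : IsUnstable f (w₀, 0) :=
  isUnstable_of_linearization hf (by simpa [hg0, mul_comm] using hg.isLittleO) had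

theorem isUnstable_planar_complex {f : ℂ × ℂ → ℂ × ℂ} {g : ℂ → ℂ} {w₀ : ℂ} {a d : ℝ}
    (hf : ∀ x, f x = (x.2, a • x.2 + g x.1)) (hg0 : g w₀ = 0) (hg : HasDerivAt g (d : ℂ) w₀)
    (hd : 0 < d) : IsUnstable f (w₀, 0) :=
  isUnstable_of_linearization hf (by simpa [hg0, mul_comm] using hg.isLittleO) (Or.inl hd)

end EmdenFowler

/-! ### Signs of a, d and the discriminant at each critical point. -/

open EmdenFowler in
theorem mainTheorem1 (n B : ℝ) (hn : 1 < n) (hB : 0 < B) :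
    -- the origin, for every real continuation of `w^n` to negative `w`
    (∀ σ : ℝ,
      IsCriticalPoint (field n B (realPow σ n)) (0, 0) ∧
      (IsLinearlyStable (field n B (realPow σ n)) (0, 0) ↔ n < 3) ∧
      (n < 3 → IsNodalSink (field n B (realPow σ n)) (0, 0) ∧
        IsAsymptoticallyStable (field n B (realPow σ n)) (0, 0)) ∧
      (3 < n → IsSaddle (field n B (realPow σ n)) (0, 0) ∧
        IsUnstable (field n B (realPow σ n)) (0, 0))) ∧
    -- the nontrivial critical point for `n > 3`
    (3 < n → ∀ σ : ℝ,
      IsCriticalPoint (field n B (realPow σ n)) (rho n B, 0) ∧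
      (IsLinearlyStable (field n B (realPow σ n)) (rho n B, 0) ↔ n < 5) ∧
      (n < 5 → IsAsymptoticallyStable (field n B (realPow σ n)) (rho n B, 0)) ∧
      (n < (11 + 8 * Real.sqrt 2) / 7 →
        IsNodalSink (field n B (realPow σ n)) (rho n B, 0)) ∧
      ((11 + 8 * Real.sqrt 2) / 7 < n → n < 5 →
        IsSpiralSink (field n B (realPow σ n)) (rho n B, 0)) ∧
      (5 < n → IsSpiralSource (field n B (realPow σ n)) (rho n B, 0) ∧
        IsUnstable (field n B (realPow σ n)) (rho n B, 0))) ∧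
    -- the nontrivial critical points for `n < 3`: all complex values of `(-1)^(1/(n-1))`,
    -- and the real reading `(-1)^(1/(n-1)) = -1`, with `w^n = |w|^n` for `w < 0`
    (n < 3 →
      (∀ k : ℤ,
        IsSaddle (field n B (branchPow (logRoot n B k) n)) (Complex.exp (logRoot n B k), 0) ∧
        ¬ IsLinearlyStable (field n B (branchPow (logRoot n B k) n))
          (Complex.exp (logRoot n B k), 0) ∧
        IsUnstable (field n B (branchPow (logRoot n B k) n))
          (Complex.exp (logRoot n B k), 0)) ∧
      IsSaddle (field n B (realPow 1 n)) (-rho n B, 0) ∧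
      ¬ IsLinearlyStable (field n B (realPow 1 n)) (-rho n B, 0) ∧
      IsUnstable (field n B (realPow 1 n)) (-rho n B, 0)) := by 
  have hn1 : 0 < n - 1 := by linarith
  have hmapR : ∀ r : ℝ, algebraMap ℝ ℂ ((r : ℝ) : ℝ) = r := fun _ => rfl
  have hmapC : ∀ r : ℝ, algebraMap ℂ ℂ (r : ℂ) = r := fun _ => rfl
  have hfield : ∀ P : ℝ → ℝ, ∀ x,
      field n B P x = (x.2, (n - 5) / (n - 1) * x.2 + forcing n B P x.1) :=
    fun P x => field_apply n B P x
  refine ⟨fun σ => ?_, fun hn3 σ => ?_, fun hn3 => ?_⟩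
  · have hP := hasStrictDerivAt_realPow_zero σ hn
    have hg0 : forcing n B (realPow σ n) 0 = 0 := by
      simp [forcing, realPow, Real.zero_rpow (by linarith : n ≠ 0)]
    have hg := hasStrictDerivAt_forcing (n := n) (B := B) (p := 0) hP
    have hgd := hg.hasDerivAt
    have hf := hfield (realPow σ n)
    have hd : 2 * (n - 3) / (n - 1) ^ 2 - B ^ (n - 1) * 0 < 0 ↔ n < 3 := by
      rw [mul_zero, sub_zero, div_lt_iff₀ (by positivity), zero_mul]
      constructor <;> intro h <;> linarith
    -- Discriminant 1 gives the eigenvalues -2/(n-1) and (n-3)/(n-1).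
    have hD : ((n - 5) / (n - 1)) ^ 2 + 4 * (2 * (n - 3) / (n - 1) ^ 2 - B ^ (n - 1) * 0) = 1 := by
      field_simp
      ring
    have ha : n < 3 → (n - 5) / (n - 1) < 0 := fun h => div_neg_of_neg_of_pos (by linarith) hn1
    refine ⟨isCriticalPoint_planar hf hg0 hgd, ?_, fun h => ⟨?_, ?_⟩, fun h => ⟨?_, ?_⟩⟩
    · rw [isLinearlyStable_planar_iff hmapR hf hgd]
      exact ⟨fun h => hd.1 h.2, fun h => ⟨ha h, hd.2 h⟩⟩
    · exact isNodalSink_planar hmapR hf hg0 hgd (one_pos.trans_eq hD.symm) (ha h) (hd.2 h)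
    · exact isAsymptoticallyStable_of_linearization hf hg0 hg (ha h) (hd.2 h)
    all_goals
      have hpos : 0 < 2 * (n - 3) / (n - 1) ^ 2 - B ^ (n - 1) * 0 := by
        rw [mul_zero, sub_zero]
        exact div_pos (by linarith) (by positivity)
    · exact isSaddle_planar hmapR hf hg0 hgd hpos
    · exact isUnstable_planar_real hf hg0 hgd (Or.inl hpos)
  · have hρ := rho_pos hn hn3.ne' hB
    have hBρ := mul_rho_rpow hn hn3.ne' hB
    rw [abs_of_pos (by linarith)] at hBρ
    have hP := hasStrictDerivAt_realPow_of_pos σ n hρ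
    have hg0 : forcing n B (realPow σ n) (rho n B) = 0 := by
      have h : rho n B ^ n = rho n B ^ (n - 1) * rho n B := by
        rw [← Real.rpow_add_one hρ.ne', sub_add_cancel]
      simp only [forcing, realPow, hρ.le, if_true, smul_eq_mul]
      rw [h, ← mul_assoc, hBρ, sub_self]
    have hg := hasStrictDerivAt_forcing (n := n) (B := B) (p := n * rho n B ^ (n - 1)) hP
    have hdeq : 2 * (n - 3) / (n - 1) ^ 2 - B ^ (n - 1) * (n * rho n B ^ (n - 1))
        = -(2 * (n - 3) / (n - 1)) := by
      rw [mul_left_comm, hBρ]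
      field_simp
      ring
    rw [hdeq] at hg
    have hgd := hg.hasDerivAt
    have hf := hfield (realPow σ n)
    have hd : -(2 * (n - 3) / (n - 1)) < 0 := neg_neg_of_pos (div_pos (by linarith) hn1)
    have ha : (n - 5) / (n - 1) < 0 ↔ n < 5 := by
      rw [div_lt_iff₀ hn1, zero_mul, sub_neg]
    -- Completing the square exposes the threshold 7n - 11 = 8√2; the other root of the numerator,
    -- (11 - 8√2)/7, lies below 1 and plays no role.
    have hD : ((n - 5) / (n - 1)) ^ 2 + 4 * -(2 * (n - 3) / (n - 1))
        = (128 - (7 * n - 11) ^ 2) / (7 * (n - 1) ^ 2) := by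
      field_simp
      ring
    have hsq : (8 * √2) ^ 2 = 128 := by
      rw [mul_pow, Real.sq_sqrt (by norm_num)]
      norm_num
    have hsq0 : 0 < 8 * √2 := by positivity
    have hneg : (11 + 8 * √2) / 7 < n →
        ((n - 5) / (n - 1)) ^ 2 + 4 * -(2 * (n - 3) / (n - 1)) < 0 := by
      intro h
      rw [div_lt_iff₀ (by norm_num)] at h
      rw [hD]
      exact div_neg_of_neg_of_pos (by nlinarith) (by positivity)
    have hlt5 : (11 + 8 * √2) / 7 < 5 := by nlinarith
    refine ⟨isCriticalPoint_planar hf hg0 hgd, ?_, fun h => ?_, fun h => ?_, fun h h5 => ?_,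
      fun h => ⟨?_, ?_⟩⟩
    · rw [isLinearlyStable_planar_iff hmapR hf hgd, ha]
      exact and_iff_left hd
    · exact isAsymptoticallyStable_of_linearization hf hg0 hg (ha.2 h) hd
    · refine isNodalSink_planar hmapR hf hg0 hgd ?_ (ha.2 (h.trans hlt5)) hd
      rw [lt_div_iff₀ (by norm_num)] at h
      rw [hD]
      exact div_pos (by nlinarith) (by positivity)
    · exact isSpiralSink_planar hmapR hf hg0 hgd (hneg h) (ha.2 h5)
    · exact isSpiralSource_planar hmapR hf hg0 hgd (hneg (hlt5.trans h))
        (div_pos (by linarith) hn1)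
    · exact isUnstable_planar_real hf hg0 hgd (Or.inr ⟨hd, div_pos (by linarith) hn1⟩)
  · have hρ := rho_pos hn hn3.ne hB
    have hBρ := mul_rho_rpow hn hn3.ne hB
    rw [abs_of_neg (by linarith)] at hBρ
    -- In both readings the power has derivative -nρ^(n-1) at the critical point, so this single
    -- positive d serves the complex and the real case.
    have hdeq : 2 * (n - 3) / (n - 1) ^ 2 - B ^ (n - 1) * -(n * rho n B ^ (n - 1))
        = 2 * (3 - n) / (n - 1) := by
      rw [mul_neg, mul_left_comm, hBρ]
      field_simp
      ring
    have hd : 0 < 2 * (3 - n) / (n - 1) := div_pos (by linarith) hn1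
    refine ⟨fun k => ?_, ?_⟩
    · have hexp := exp_mul_logRoot hn hρ k
      have hP := hasStrictDerivAt_branchPow (logRoot n B k) n
      have hval := branchPow_exp (logRoot n B k) n
      set s := logRoot n B k
      have hP' : HasStrictDerivAt (branchPow s n) ((-(n * rho n B ^ (n - 1)) : ℝ) : ℂ)
          (Complex.exp s) := by
        rw [hexp] at hP
        convert hP using 1
        push_cast
        ring
      have hg0 : forcing n B (branchPow s n) (Complex.exp s) = 0 := by
        have h1 : Complex.exp (n * s) = ((-(rho n B ^ (n - 1)) : ℝ) : ℂ) * Complex.exp s := by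
          rw [← hexp, ← Complex.exp_add]
          ring_nf
        have h2 := congrArg ((↑) : ℝ → ℂ) hBρ
        rw [forcing, hval, h1, Complex.real_smul, Complex.real_smul]
        push_cast at h2 ⊢
        linear_combination Complex.exp s * h2
      have hg := hasStrictDerivAt_forcing (n := n) (B := B) (p := -(n * rho n B ^ (n - 1))) hP'
      rw [hdeq] at hg
      have hgd := hg.hasDerivAt
      have hf := field_apply n B (branchPow s n)
      refine ⟨isSaddle_planar hmapC hf hg0 hgd hd, ?_, isUnstable_planar_complex hf hg0 hgd hd⟩
      rw [isLinearlyStable_planar_iff hmapC hf hgd]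
      exact fun h => hd.not_gt h.2
    · have hP := hasStrictDerivAt_realPow_one_of_neg n (neg_neg_of_pos hρ)
      rw [neg_neg] at hP
      have hg0 : forcing n B (realPow 1 n) (-rho n B) = 0 := by
        have h : rho n B ^ n = rho n B ^ (n - 1) * rho n B := by
          rw [← Real.rpow_add_one hρ.ne', sub_add_cancel]
        simp only [forcing, realPow, not_le.2 (neg_neg_of_pos hρ), if_false, smul_eq_mul, neg_neg,
          one_mul]
        rw [h, ← mul_assoc, hBρ]
        ring
      have hg := hasStrictDerivAt_forcing (n := n) (B := B) (p := -(n * rho n B ^ (n - 1))) hP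
      rw [hdeq] at hg
      have hgd := hg.hasDerivAt
      have hf := hfield (realPow 1 n)
      refine ⟨isSaddle_planar hmapR hf hg0 hgd hd, ?_,
        isUnstable_planar_real hf hg0 hgd (Or.inl hd)⟩
      rw [isLinearlyStable_planar_iff hmapR hf hgd]
      exact fun h => hd.not_gt h.2
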